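/- Let INF be the first-order theory with equality, in intuitionistic logic, whose only non-logical symbol is $\in$ and whose axioms are extensionality $\forall x\forall y\,(\forall z\,(z\in x\leftrightarrow z\in y)\to x=y)$ and stratified comprehension $\exists y\,\forall x\,(x\in y\leftrightarrow\varphi(x))$ for every stratified formula $\varphi$ (parameters allowed) in which $y$ does not occur. Here $\varphi$ is stratified if one can assign an integer index to each of its variables so that the two variables in every subformula $x=y$ have equal indices, and in every subformula $x\in y$ the index of $y$ is one more than that of $x$. In INF define the following. * $\langle x,y\rangle=\{\{x\},\{x,y\}\}$; $\mathsf{FUNC}$ is the set of all $f$ such that $\langle x,y\rangle\in f$ and $\langle x,z\rangle\in f$ imply $y=z$; $Rel(f)$ means that all members of $f$ are ordered pairs; $Ap(f,x)=\{t:\exists y\,(\langle x,y\rangle\in f\wedge t\in y)\}$; $\mathsf{id}=\{\langle x,x\rangle:x=x\}$. * $\mathbf 0=\{\langle f,\mathsf{id}\rangle:f=f\}$. Church successor $\mathsf S$ is the set of all pairs $\langle z,y\rangle$ with $z\in\mathsf{FUNC}$, where $y$ is the set of all pairs $\langle f,p\rangle$ with $f\in\mathsf{FUNC}$ and $p=\{\langle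 x,w\rangle:\exists t\,\exists q\,(t\in\mathsf{FUNC}\wedge\langle f,t\rangle\in z\wedge\langle x,q\rangle\in t\wedge\langle q,w\rangle\in f)\}$. Write $\mathsf Su$ for $Ap(\mathsf S,u)$. * $\mathbb N$, the set of Church numbers, is the intersection of all sets $X$ such that $\mathbf 0\in X$ and $\mathsf Su\in X$ for all $u\in X$. * $X$ is finite if $X$ belongs to every $W$ such that $\emptyset\in W$, and $u\cup\{c\}\in W$ whenever $u\in W$ and $c\notin u$. * $X$ is infinite if there is a set $Y\subseteq X$ with $Y\ne X$ that is similar to $X$, that is, there is $f\in\mathsf{FUNC}$ with $Rel(f)$ that is one-to-one with domain $X$ and range $Y$. Then INF (with no counting axiom) proves that the set $\mathbb N$ exists, and that if $\mathbb N$ is not finite, then 1. Church successor is weakly one-to-one on $\mathbb N$: for all $x,y\in\mathbb N$, $x\neq y$ implies $\mathsf Sx\neq\mathsf Sy$; 2. Church successor is one-to-one on $\mathbb N$: for all $x,y\in\mathbb N$, $\mathsf Sx=\mathsf Sy$ implies $x=y$; 3. $\mathbb N$ has decidable equality: for all $x,y\in\mathbb N$, $x=y$ or $x\ne y$; 4.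 $\mathbb N$ is infinite. -/

import Mathlib

namespace INF

/-! ### First-order formulas in the language of set theory

The logical symbols are `⊥, ∧, ∨, →, ∀, ∃` and `=`, the only non-logical symbol is `∈`.
Variables are de Bruijn indices: under a quantifier, index `0` is the variable just bound and
index `n + 1` is what index `n` was outside. There are no terms other than variables. -/

/-- Formulas: `mem i j` is `i ∈ j`, `eq i j` is `i = j`. -/
inductive Fml : Type
  | mem (i j : ℕ) : Fml
  | eq (i j : ℕ) : Fml
  | bot : Fml
  | and (φ ψ : Fml) : Fml
  | or (φ ψ : Fml) : Fml
  | imp (φ ψ : Fml) : Fml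
  | all (φ : Fml) : Fml
  | ex (φ : Fml) : Fml

infixr:35 " ⋏ " => Fml.and
infixr:30 " ⋎ " => Fml.or
infixr:25 " ➝ " => Fml.imp

namespace Fml

/-- Negation, `φ → ⊥`. -/
def neg (φ : Fml) : Fml := φ ➝ bot

/-- The biconditional. -/
def iff (φ ψ : Fml) : Fml := (φ ➝ ψ) ⋏ (ψ ➝ φ)

/-- The action of a map of variables below a quantifier. -/
def lift (ρ : ℕ → ℕ) : ℕ → ℕ
  | 0 => 0
  | n + 1 => ρ n + 1

/-- Simultaneous (capture-avoiding) substitution of the variable `ρ n` for the variable `n`. -/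
def rename : (ℕ → ℕ) → Fml → Fml
  | ρ, mem i j => mem (ρ i) (ρ j)
  | ρ, eq i j => eq (ρ i) (ρ j)
  | _, bot => bot
  | ρ, and φ ψ => and (rename ρ φ) (rename ρ ψ)
  | ρ, or φ ψ => or (rename ρ φ) (rename ρ ψ)
  | ρ, imp φ ψ => imp (rename ρ φ) (rename ρ ψ)
  | ρ, all φ => all (rename (lift ρ) φ)
  | ρ, ex φ => ex (rename (lift ρ) φ)

/-- `φ` placed below one more quantifier, which does not bind any variable of `φ`. -/
def shift (φ : Fml) : Fml := rename Nat.succ φ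

/-- The map of variables `0 ↦ t`, `n + 1 ↦ n`. -/
def point (t : ℕ) : ℕ → ℕ
  | 0 => t
  | n + 1 => n

/-- The instance `φ(t)` of the body `φ` of a quantifier. -/
def inst (φ : Fml) (t : ℕ) : Fml := rename (point t) φ

/-- Extend an assignment of indices by giving the newly bound variable the index `k`. -/
def extend (k : ℤ) (σ : ℕ → ℤ) : ℕ → ℤ
  | 0 => k
  | n + 1 => σ n

/-- `φ` is stratified by indices that extend the assignment `σ` for its free variables:
`x = y` forces equal indices, `x ∈ y` forces the index of `y` to be one more than that of `x`. -/
def StratifiedBy : (ℕ → ℤ) → Fml → Prop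
  | σ, mem i j => σ j = σ i + 1
  | σ, eq i j => σ i = σ j
  | _, bot => True
  | σ, and φ ψ => StratifiedBy σ φ ∧ StratifiedBy σ ψ
  | σ, or φ ψ => StratifiedBy σ φ ∧ StratifiedBy σ ψ
  | σ, imp φ ψ => StratifiedBy σ φ ∧ StratifiedBy σ ψ
  | σ, all φ => ∃ k : ℤ, StratifiedBy (extend k σ) φ
  | σ, ex φ => ∃ k : ℤ, StratifiedBy (extend k σ) φ

/-- A formula is stratified if its variables can be given suitable indices. -/
def Stratified (φ : Fml) : Prop := ∃ σ : ℕ → ℤ, StratifiedBy σ φ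

end Fml

open Fml

/-! ### The theory INF -/

/-- The non-logical axioms of INF. A free variable of an axiom is read as universally
quantified. -/
inductive Axm : Fml → Prop
  /-- Extensionality: `∀ x y, (∀ z, z ∈ x ↔ z ∈ y) → x = y`. -/
  | ext : Axm (all (all (all (iff (mem 0 2) (mem 0 1)) ➝ eq 1 0)))
  /-- Stratified comprehension: `∃ y, ∀ x, x ∈ y ↔ φ(x)` where `φ` is stratified, `x` is its
  variable `0`, `y` does not occur in it, and its other free variables are parameters. -/
  | comp (φ : Fml) : Stratified φ → Axm (ex (all (iff (mem 0 1) (rename (lift Nat.succ) φ))))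

/-- Intuitionistic natural deduction with equality from the axioms of INF: `Der Γ φ` means that
`φ` is derivable from the hypotheses `Γ`. -/
inductive Der : List Fml → Fml → Prop
  | axm {Γ : List Fml} {φ : Fml} : Axm φ → Der Γ φ
  | hyp {Γ : List Fml} {φ : Fml} : φ ∈ Γ → Der Γ φ
  | botE {Γ : List Fml} {φ : Fml} : Der Γ bot → Der Γ φ
  | andI {Γ : List Fml} {φ ψ : Fml} : Der Γ φ → Der Γ ψ → Der Γ (φ ⋏ ψ)
  | andL {Γ : List Fml} {φ ψ : Fml} : Der Γ (φ ⋏ ψ) → Der Γ φ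
  | andR {Γ : List Fml} {φ ψ : Fml} : Der Γ (φ ⋏ ψ) → Der Γ ψ
  | orL {Γ : List Fml} {φ ψ : Fml} : Der Γ φ → Der Γ (φ ⋎ ψ)
  | orR {Γ : List Fml} {φ ψ : Fml} : Der Γ ψ → Der Γ (φ ⋎ ψ)
  | orE {Γ : List Fml} {φ ψ χ : Fml} :
      Der Γ (φ ⋎ ψ) → Der (φ :: Γ) χ → Der (ψ :: Γ) χ → Der Γ χ
  | impI {Γ : List Fml} {φ ψ : Fml} : Der (φ :: Γ) ψ → Der Γ (φ ➝ ψ)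
  | impE {Γ : List Fml} {φ ψ : Fml} : Der Γ (φ ➝ ψ) → Der Γ φ → Der Γ ψ
  | allI {Γ : List Fml} {φ : Fml} : Der (Γ.map shift) φ → Der Γ (all φ)
  | allE {Γ : List Fml} {φ : Fml} (t : ℕ) : Der Γ (all φ) → Der Γ (φ.inst t)
  | exI {Γ : List Fml} {φ : Fml} (t : ℕ) : Der Γ (φ.inst t) → Der Γ (ex φ)
  | exE {Γ : List Fml} {φ ψ : Fml} :
      Der Γ (ex φ) → Der (φ :: Γ.map shift) (shift ψ) → Der Γ ψ
  | eqI {Γ : List Fml} (t : ℕ) : Der Γ (eq t t)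
  | eqE {Γ : List Fml} {φ : Fml} {s t : ℕ} : Der Γ (eq s t) → Der Γ (φ.inst s) → Der Γ (φ.inst t)

/-- INF proves `φ`. -/
def Provable (φ : Fml) : Prop := Der [] φ

/-! ### Set-theoretic notions, as formulas

The arguments of the following definitions are variables; an argument that is used below `k`
quantifiers is shifted to `x + k`. -/

/-- `x ⊆ y`. -/
def subset (x y : ℕ) : Fml := all (mem 0 (x + 1) ➝ mem 0 (y + 1))

/-- `e = Λ`, the empty set. -/
def isEmpty (e : ℕ) : Fml := all (neg (mem 0 (e + 1)))

/-- `r = u ∪ {c}`. -/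
def isAdjoin (r u c : ℕ) : Fml :=
  all (iff (mem 0 (r + 1)) (mem 0 (u + 1) ⋎ eq 0 (c + 1)))

/-- `p = {x, y}`. -/
def isUPair (p x y : ℕ) : Fml := all (iff (mem 0 (p + 1)) (eq 0 (x + 1) ⋎ eq 0 (y + 1)))

/-- `p = ⟨x, y⟩ = {{x}, {x, y}}`. -/
def isPair (p x y : ℕ) : Fml :=
  all (iff (mem 0 (p + 1)) (isUPair 0 (x + 1) (x + 1) ⋎ isUPair 0 (x + 1) (y + 1)))

/-- `⟨x, y⟩ ∈ f`. -/
def pairMem (x y f : ℕ) : Fml := ex (isPair 0 (x + 1) (y + 1) ⋏ mem 0 (f + 1))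

/-- `f ∈ FUNC`: `∀ x y z, ⟨x, y⟩ ∈ f → ⟨x, z⟩ ∈ f → y = z`. -/
def isFunc (f : ℕ) : Fml :=
  all (all (all (pairMem 2 1 (f + 3) ➝ pairMem 2 0 (f + 3) ➝ eq 1 0)))

/-- `Rel(f)`: all members of `f` are ordered pairs. -/
def isRel (f : ℕ) : Fml := all (mem 0 (f + 1) ➝ ex (ex (isPair 2 1 0)))

/-- `f : X → Y`: for every `x ∈ X` there is a unique `y` with `⟨x, y⟩ ∈ f`, and it is in `Y`. -/
def maps (f X Y : ℕ) : Fml :=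
  all (mem 0 (X + 1) ➝
    ex (mem 0 (Y + 2) ⋏ pairMem 1 0 (f + 2) ⋏ all (pairMem 2 0 (f + 3) ➝ eq 0 1)))

/-- `f` is one-to-one from `X` to `Y`: `f : X → Y`, and `⟨x, y⟩ ∈ f`, `⟨u, y⟩ ∈ f` imply `x = u`,
and `⟨x, y⟩ ∈ f`, `y ∈ Y` imply `x ∈ X`. -/
def oneOne (f X Y : ℕ) : Fml :=
  maps f X Y ⋏
  all (all (all (pairMem 2 0 (f + 3) ➝ pairMem 1 0 (f + 3) ➝ eq 2 1))) ⋏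
  all (all (pairMem 1 0 (f + 2) ➝ mem 0 (Y + 2) ➝ mem 1 (X + 2)))

/-- `dom(f) ⊆ X`. -/
def domSubset (f X : ℕ) : Fml := all (all (pairMem 1 0 (f + 2) ➝ mem 1 (X + 2)))

/-- `f` maps `X` onto `Y`: every `y ∈ Y` has some `x ∈ X` with `⟨x, y⟩ ∈ f`. -/
def onto (f X Y : ℕ) : Fml :=
  all (mem 0 (Y + 1) ➝ ex (mem 0 (X + 2) ⋏ pairMem 0 1 (f + 2)))

/-- `X ∼ Y`: there is a similarity (a one-to-one function with domain `X`, onto `Y`). -/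
def similar (X Y : ℕ) : Fml :=
  ex (isRel 0 ⋏ isFunc 0 ⋏ domSubset 0 (X + 1) ⋏ oneOne 0 (X + 1) (Y + 1) ⋏
    onto 0 (X + 1) (Y + 1))

/-- `X` is infinite: `X` is similar to some `Y ⊆ X` with `Y ≠ X`. -/
def infinite (X : ℕ) : Fml :=
  ex (subset 0 (X + 1) ⋏ neg (eq 0 (X + 1)) ⋏ similar (X + 1) 0)

/-- `X ∈ FINITE`: `X` belongs to every `W` such that `Λ ∈ W`, and `u ∪ {c} ∈ W` whenever
`u ∈ W` and `c ∉ u`. -/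
def finite (X : ℕ) : Fml :=
  all (ex (isEmpty 0 ⋏ mem 0 1) ⋏
      all (all (mem 1 2 ➝ neg (mem 0 1) ➝ ex (isAdjoin 0 2 1 ⋏ mem 0 3))) ➝
    mem (X + 1) 0)

/-- `X` has decidable equality: `∀ x y ∈ X, x = y ∨ x ≠ y`. -/
def decidableEq (X : ℕ) : Fml :=
  all (all (mem 1 (X + 2) ➝ mem 0 (X + 2) ➝ (eq 1 0 ⋎ neg (eq 1 0))))

/-! ### Church numbers -/

/-- `∃ x w t q, u = ⟨x, w⟩ ∧ t ∈ FUNC ∧ ⟨f, t⟩ ∈ z ∧ ⟨x, q⟩ ∈ t ∧ ⟨q, w⟩ ∈ f`; that is,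
`u = ⟨x, f(z f x)⟩` for some `x`. -/
def memSuccApp (u f z : ℕ) : Fml :=
  ex (ex (ex (ex (isPair (u + 4) 3 2 ⋏ isFunc 1 ⋏ pairMem (f + 4) 1 (z + 4) ⋏
    pairMem 3 0 1 ⋏ pairMem 0 2 (f + 4)))))

/-- `⟨z, y⟩ ∈ S`, where `S` is Church successor: `z ∈ FUNC` and `y` is the set of all `⟨f, p⟩`
with `f ∈ FUNC` and `∀ u, u ∈ p ↔ memSuccApp u f z`. -/
def succGraph (z y : ℕ) : Fml :=
  isFunc z ⋏
  all (iff (mem 0 (y + 1))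
    (ex (ex (isPair 2 1 0 ⋏ isFunc 1 ⋏ all (iff (mem 0 1) (memSuccApp 0 2 (z + 4)))))))

/-- `v = S u`, that is, `v = Ap(S, u) = {t : ∃ y, ⟨u, y⟩ ∈ S ∧ t ∈ y}`. -/
def isSucc (v u : ℕ) : Fml :=
  all (iff (mem 0 (v + 1)) (ex (succGraph (u + 2) 0 ⋏ mem 1 0)))

/-- `i = id = {⟨x, x⟩ : x = x}`. -/
def isId (i : ℕ) : Fml := all (iff (mem 0 (i + 1)) (ex (isPair 1 0 0)))

/-- `z` is the Church number `0 = {⟨f, id⟩ : f = f}`. -/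
def isZero (z : ℕ) : Fml := all (iff (mem 0 (z + 1)) (ex (ex (isId 0 ⋏ isPair 2 1 0))))

/-- `N` is the set `ℕ` of Church numbers, the intersection of all `X` that contain `0` and are
closed under Church successor. -/
def isChurchNumbers (N : ℕ) : Fml :=
  all (iff (mem 0 (N + 1))
    (ex (isZero 0 ⋏
      all (mem 1 0 ⋏ all (mem 0 1 ➝ ex (isSucc 0 1 ⋏ mem 0 2)) ➝ mem 2 0))))

/-- `S x = S y`. -/
def sameSucc (x y : ℕ) : Fml := ex (isSucc 0 (x + 1) ⋏ isSucc 0 (y + 1))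

/-- Church successor is weakly one-to-one on `N`: `∀ x y ∈ N, x ≠ y → S x ≠ S y`. -/
def succWeaklyOneOne (N : ℕ) : Fml :=
  all (all (mem 1 (N + 2) ➝ mem 0 (N + 2) ➝ neg (eq 1 0) ➝ neg (sameSucc 1 0)))

/-- Church successor is one-to-one on `N`: `∀ x y ∈ N, S x = S y → x = y`. -/
def succOneOne (N : ℕ) : Fml :=
  all (all (mem 1 (N + 2) ➝ mem 0 (N + 2) ➝ sameSucc 1 0 ➝ eq 1 0))

end INF

namespace INF
open Fml

/-! ### Renaming of variables -/

namespace Fml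

/-! All that is used of Church successor is that `S x` exists, is unique, and can be given the same
index as `x`. So `ℕ` exists by stratified comprehension, and stratified induction holds on it.

The carrier of the argument is the segment from `0` to a number `k`: a finite set containing `0` and
`k`, closed under `S` except possibly at `k`, and generated from `0` by steps of `S` inside it. If
`S k` lay in a segment `u` of `k`, then `u` would be closed under `S`, so `ℕ ⊆ u`; generation gives
`u ⊆ ℕ`, and `ℕ = u` would be finite (`segment_succ`). Hence `S k ∉ u`, adjoining `S k` keeps the
set finite, and by induction every number has a segment (`segment_exists`). The assumption on `ℕ`
enters through `segment_succ` alone.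

As `0` lies in every segment, `0` is not a successor. If `x ≠ y` had a common successor `v`, with
segments `u` and `w`, then `v` is in neither; so `y ∉ u`, so `u` is generated without passing the
exception `y` of `w`, and `u ⊆ w`. Now `x ∈ w` forces `x = y` or `v ∈ w`, which is absurd
(`segment_succ_ne`). Weak injectivity yields decidable equality by induction, decidability removes
the double negation in injectivity, and `S` is a similarity of `ℕ` with an image that omits `0`.

The logic is formalized with de Bruijn variables; `allI'` and `exE'` replace eigenvariables by
quantification over variables in the metatheory. -/

theorem lift_comp (ρ τ : ℕ → ℕ) : lift ρ ∘ lift τ = lift (ρ ∘ τ) := by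
  funext n; cases n <;> rfl

theorem rename_rename (ρ τ : ℕ → ℕ) (φ : Fml) :
    rename ρ (rename τ φ) = rename (ρ ∘ τ) φ := by
  induction φ generalizing ρ τ <;> simp_all [rename, ← lift_comp]

/-- A strict upper bound for the free variables of a formula. -/
def bound : Fml → ℕ
  | mem i j => max (i + 1) (j + 1)
  | eq i j => max (i + 1) (j + 1)
  | bot => 0
  | and φ ψ => max (bound φ) (bound ψ)
  | or φ ψ => max (bound φ) (bound ψ)
  | imp φ ψ => max (bound φ) (bound ψ)
  | all φ => bound φ - 1
  | ex φ => bound φ - 1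

theorem rename_congr {ρ τ : ℕ → ℕ} {φ : Fml} (h : ∀ n < φ.bound, ρ n = τ n) :
    rename ρ φ = rename τ φ := by
  have key : ∀ (ρ τ : ℕ → ℕ) (b : ℕ), (∀ n < b - 1, ρ n = τ n) → ∀ n < b, lift ρ n = lift τ n := by
    intro ρ τ b h n hn
    cases n with
    | zero => rfl
    | succ n => simp [lift, h n (by omega)]
  induction φ generalizing ρ τ with
  | mem i j => simp [rename, h i (by simp [bound]), h j (by simp [bound])]
  | eq i j => simp [rename, h i (by simp [bound]), h j (by simp [bound])]
  | bot => rfl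
  | and φ ψ h₁ h₂ | or φ ψ h₁ h₂ | imp φ ψ h₁ h₂ =>
    simp only [rename]
    rw [h₁ fun n hn => h n (lt_max_of_lt_left hn), h₂ fun n hn => h n (lt_max_of_lt_right hn)]
  | all φ ih | ex φ ih =>
    simp only [rename]
    rw [ih (key _ _ _ h)]

theorem rename_eq_self {ρ : ℕ → ℕ} {φ : Fml} (h : ∀ n < φ.bound, ρ n = n) :
    rename ρ φ = φ := by
  have id_rename : ∀ φ : Fml, rename id φ = φ := by
    have : lift id = id := by funext n; cases n <;> rfl
    intro φ; induction φ <;> simp_all [rename]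
  rw [rename_congr (τ := id) h, id_rename]

theorem rename_shift (ρ : ℕ → ℕ) (φ : Fml) :
    rename (lift ρ) (shift φ) = shift (rename ρ φ) := by
  simp only [shift, rename_rename]; rfl

theorem rename_inst (ρ : ℕ → ℕ) (φ : Fml) (t : ℕ) :
    rename ρ (φ.inst t) = (rename (lift ρ) φ).inst (ρ t) := by
  simp only [inst, rename_rename]
  congr 1; funext n; cases n <;> rfl

theorem inst_shift (φ : Fml) (t : ℕ) : (shift φ).inst t = φ := by
  simp only [inst, shift, rename_rename]
  exact rename_eq_self fun _ _ => rfl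

theorem stratifiedBy_rename (σ : ℕ → ℤ) (ρ : ℕ → ℕ) (φ : Fml) :
    StratifiedBy σ (rename ρ φ) ↔ StratifiedBy (σ ∘ ρ) φ := by
  have key : ∀ (σ : ℕ → ℤ) (ρ : ℕ → ℕ) (k : ℤ), extend k σ ∘ lift ρ = extend k (σ ∘ ρ) := by
    intro σ ρ k; funext n; cases n <;> rfl
  induction φ generalizing σ ρ <;> simp_all [rename, StratifiedBy]

end Fml

/-! ### Admissible rules -/

/-- A left inverse of `ρ` is needed because identifying variables can destroy stratification. -/
theorem Axm.rename {φ : Fml} (h : Axm φ) {ρ g : ℕ → ℕ} (hg : ∀ n, g (ρ n) = n) :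
    Axm (φ.rename ρ) := by
  cases h with
  | ext => exact Axm.ext
  | comp φ h =>
    obtain ⟨σ, h⟩ := h
    have e : Fml.rename (lift (lift ρ)) (Fml.rename (lift Nat.succ) φ) =
        Fml.rename (lift Nat.succ) (Fml.rename (lift ρ) φ) := by
      simp only [rename_rename, lift_comp]; rfl
    -- The index of a renamed variable is read off from its origin under `g`.
    have := Axm.comp (Fml.rename (lift ρ) φ) ⟨σ ∘ lift g, by
      rw [stratifiedBy_rename]
      convert h using 1
      funext n; cases n <;> simp [lift, hg]⟩
    rw [← e] at this
    exact this

namespace Der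

theorem mono {Γ Δ : List Fml} {φ : Fml} (h : Der Γ φ) (hs : Γ ⊆ Δ) : Der Δ φ := by
  induction h generalizing Δ with
  | axm h => exact axm h
  | hyp h => exact hyp (hs h)
  | botE _ ih => exact botE (ih hs)
  | andI _ _ h₁ h₂ => exact andI (h₁ hs) (h₂ hs)
  | andL _ ih => exact andL (ih hs)
  | andR _ ih => exact andR (ih hs)
  | orL _ ih => exact orL (ih hs)
  | orR _ ih => exact orR (ih hs)
  | orE _ _ _ h h₁ h₂ =>
    exact orE (h hs) (h₁ (List.cons_subset_cons _ hs)) (h₂ (List.cons_subset_cons _ hs))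
  | impI _ ih => exact impI (ih (List.cons_subset_cons _ hs))
  | impE _ _ h₁ h₂ => exact impE (h₁ hs) (h₂ hs)
  | allI _ ih => exact allI (ih (List.map_subset _ hs))
  | allE t _ ih => exact allE t (ih hs)
  | exI t _ ih => exact exI t (ih hs)
  | exE _ _ h₁ h₂ => exact exE (h₁ hs) (h₂ (List.cons_subset_cons _ (List.map_subset _ hs)))
  | eqI t => exact eqI t
  | eqE _ _ h₁ h₂ => exact eqE (h₁ hs) (h₂ hs)

theorem rename {Γ : List Fml} {φ : Fml} (h : Der Γ φ) {ρ g : ℕ → ℕ} (hg : ∀ n, g (ρ n) = n) :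
    Der (Γ.map (Fml.rename ρ)) (φ.rename ρ) := by
  have hl : ∀ {ρ g : ℕ → ℕ}, (∀ n, g (ρ n) = n) → ∀ n, lift g (lift ρ n) = n := by
    intro ρ g h n; cases n <;> simp [lift, h]
  have hm : ∀ (ρ : ℕ → ℕ) (Γ : List Fml),
      (Γ.map shift).map (Fml.rename (lift ρ)) = (Γ.map (Fml.rename ρ)).map shift := by
    intro ρ Γ; simp [rename_shift]
  induction h generalizing ρ g with
  | axm h => exact axm (h.rename hg)
  | hyp h => exact hyp (List.mem_map_of_mem h)
  | botE _ ih => exact botE (ih hg)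
  | andI _ _ h₁ h₂ => exact andI (h₁ hg) (h₂ hg)
  | andL _ ih => exact andL (ih hg)
  | andR _ ih => exact andR (ih hg)
  | orL _ ih => exact orL (ih hg)
  | orR _ ih => exact orR (ih hg)
  | orE _ _ _ h h₁ h₂ => exact orE (h hg) (h₁ hg) (h₂ hg)
  | impI _ ih => exact impI (ih hg)
  | impE _ _ h₁ h₂ => exact impE (h₁ hg) (h₂ hg)
  | allI _ ih => exact allI (hm ρ _ ▸ ih (hl hg))
  | allE t _ ih => exact rename_inst ρ _ t ▸ allE (ρ t) (ih hg)
  | exI t _ ih => exact exI (ρ t) (rename_inst ρ _ t ▸ ih hg)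
  | exE _ _ h₁ h₂ =>
    refine exE (h₁ hg) ?_
    have := h₂ (hl hg)
    rwa [List.map_cons, hm, rename_shift] at this
  | eqI t => exact eqI (ρ t)
  | eqE _ _ h₁ h₂ =>
    rw [rename_inst]
    exact eqE (h₁ hg) (rename_inst ρ _ _ ▸ h₂ hg)

/-- Generalization over a variable that stands for an arbitrary one. -/
theorem allI' {Γ : List Fml} {φ : Fml} (h : ∀ t, Der Γ (φ.inst t)) : Der Γ (all φ) := by
  obtain ⟨b, hφ, hΓ⟩ : ∃ b, φ.bound ≤ b ∧ ∀ ψ ∈ Γ, ψ.bound ≤ b := by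
    refine ⟨φ.bound + (Γ.map bound).sum, by omega, fun ψ hψ => ?_⟩
    have := List.le_sum_of_mem (List.mem_map_of_mem (f := bound) hψ)
    omega
  -- The variable `b` is fresh. The permutation `ρ` sends it to `0` and shifts the smaller ones up,
  -- which turns the derivation at `t = b` into the premise of `allI`.
  let ρ : ℕ → ℕ := fun n => if n < b then n + 1 else if n = b then 0 else n
  let g : ℕ → ℕ := fun n => if n = 0 then b else if n ≤ b then n - 1 else n
  have hg : ∀ n, g (ρ n) = n := by
    intro n; simp only [g, ρ]; grind
  have key := (h b).rename hg
  have e₁ : Γ.map (Fml.rename ρ) = Γ.map shift :=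
    List.map_congr_left fun ψ hψ => rename_congr fun n hn => by
      have := hΓ ψ hψ
      simp [ρ, show n < b by omega]
  have e₂ : (φ.inst b).rename ρ = φ := by
    rw [inst, rename_rename]
    refine rename_eq_self fun n hn => ?_
    cases n with
    | zero => simp [point, ρ]
    | succ n => simp [point, ρ, show n < b by omega]
  exact allI (by rwa [e₁, e₂] at key)

/-- Elimination of `∃` with a variable that stands for an arbitrary one. -/
theorem exE' {Γ : List Fml} {φ ψ : Fml} (h : Der Γ (ex φ))
    (h' : ∀ t, Der (φ.inst t :: Γ) (φ.inst t) → Der (φ.inst t :: Γ) ψ) : Der Γ ψ := by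
  have hall : Der Γ (all (φ ➝ shift ψ)) := allI' fun t => by
    have := impI (h' t (hyp List.mem_cons_self))
    rwa [← inst_shift ψ t] at this
  refine exE h (impE ?_ (hyp List.mem_cons_self))
  -- The universal formula is shifted below the eigenvariable and then instantiated at that
  -- variable, which cancels the shift.
  have := allE 0 (hall.rename (ρ := Nat.succ) (g := Nat.pred) fun _ => rfl)
  have e : (Fml.rename (lift Nat.succ) (φ ➝ shift ψ)).inst 0 = (φ ➝ shift ψ) := by
    rw [inst, rename_rename]
    exact rename_eq_self fun n _ => by cases n <;> rfl
  exact mono (e ▸ this) (List.subset_cons_self _ _)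

/-- Theorems are closed under substitution of variables. -/
theorem subst {φ : Fml} (h : Der [] φ) (ρ : ℕ → ℕ) (Γ : List Fml) : Der Γ (φ.rename ρ) := by
  refine mono (Γ := []) ?_ (List.nil_subset _)
  obtain ⟨b, hb⟩ : ∃ b, φ.bound ≤ b := ⟨_, le_rfl⟩
  induction b generalizing φ ρ with
  | zero => rwa [rename_eq_self fun n hn => by omega]
  | succ b ih =>
    -- A map that identifies variables cannot act on a derivation, whose axioms might lose
    -- stratification. Instead variable `0` is quantified, the others are substituted by induction,
    -- and the result is instantiated at `ρ 0`.
    have h₁ := (ih (allI (Γ := []) h) (ρ ∘ Nat.succ) (by simp only [bound]; omega)).allE (ρ 0)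
    rw [inst, rename_rename] at h₁
    convert h₁ using 2
    funext n; cases n <;> rfl

end Der

/-! ### Stratification of the set-theoretic notions -/

section Stratification

variable {σ : ℕ → ℤ}

theorem strat_isUPair {p x y : ℕ} (h : σ p = σ x + 1) (h' : σ y = σ x) :
    StratifiedBy σ (isUPair p x y) :=
  ⟨σ x, by simp [Fml.iff, StratifiedBy, extend, h, h']⟩

theorem strat_isPair {p x y : ℕ} (h : σ p = σ x + 2) (h' : σ y = σ x) :
    StratifiedBy σ (isPair p x y) := by
  refine ⟨σ x + 1, ⟨?_, strat_isUPair ?_ ?_, strat_isUPair ?_ ?_⟩,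
    ⟨strat_isUPair ?_ ?_, strat_isUPair ?_ ?_⟩, ?_⟩ <;>
    (simp [StratifiedBy, extend, h, h']; try omega)

theorem strat_pairMem {x y f : ℕ} (h : σ f = σ x + 3) (h' : σ y = σ x) :
    StratifiedBy σ (pairMem x y f) := by
  refine ⟨σ x + 2, strat_isPair ?_ ?_, ?_⟩ <;> simp [StratifiedBy, extend, h, h'] <;> omega

theorem strat_isFunc {f : ℕ} : StratifiedBy σ (isFunc f) := by
  refine ⟨σ f - 3, σ f - 3, σ f - 3, strat_pairMem ?_ ?_, strat_pairMem ?_ ?_, ?_⟩ <;>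
    simp [StratifiedBy, extend]

theorem strat_iff {φ ψ : Fml} (h : StratifiedBy σ φ) (h' : StratifiedBy σ ψ) :
    StratifiedBy σ (iff φ ψ) := ⟨⟨h, h'⟩, h', h⟩

theorem strat_mem {x y : ℕ} (h : σ y = σ x + 1) : StratifiedBy σ (mem x y) := h

/-- A pair lies two indices above its entries. With `u = ⟨x, w⟩`, `f` is one above `u`, the pair
`⟨f, t⟩` three above, and `z` four. -/
theorem strat_memSuccApp {u f z : ℕ} (h : σ f = σ u + 1) (h' : σ z = σ u + 4) :
    StratifiedBy σ (memSuccApp u f z) := by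
  refine ⟨σ u - 2, σ u - 2, σ u + 1, σ u - 2, strat_isPair ?_ ?_, strat_isFunc,
    strat_pairMem ?_ ?_, strat_pairMem ?_ ?_, strat_pairMem ?_ ?_⟩ <;>
    (simp [extend, h, h']; try omega)

theorem strat_succGraph {z y : ℕ} (h : σ y = σ z) : StratifiedBy σ (succGraph z y) := by
  refine ⟨strat_isFunc, σ z - 1, strat_iff (strat_mem ?_) ⟨σ z - 3, σ z - 3, strat_isPair ?_ ?_,
    strat_isFunc, σ z - 4, strat_iff (strat_mem ?_) (strat_memSuccApp ?_ ?_)⟩⟩ <;>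
    (simp [extend, h]; try omega)

/-- Successor preserves the index; closure under it is therefore a stratified condition. -/
theorem strat_isSucc {v u : ℕ} (h : σ v = σ u) : StratifiedBy σ (isSucc v u) := by
  refine ⟨σ u - 1, strat_iff (strat_mem ?_) ⟨σ u, strat_succGraph ?_, strat_mem ?_⟩⟩ <;>
    simp [extend, h]

theorem strat_isId {i : ℕ} : StratifiedBy σ (isId i) := by
  refine ⟨σ i - 1, strat_iff (strat_mem ?_) ⟨σ i - 3, strat_isPair ?_ ?_⟩⟩ <;>
    (simp [extend]; try omega)

theorem strat_isZero {z : ℕ} : StratifiedBy σ (isZero z) := by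
  refine ⟨σ z - 1, strat_iff (strat_mem ?_) ⟨σ z - 3, σ z - 3, strat_isId, strat_isPair ?_ ?_⟩⟩ <;>
    (simp [extend]; try omega)

theorem strat_finite {X : ℕ} : StratifiedBy σ (finite X) := by
  refine ⟨σ X + 1, ⟨⟨σ X, ⟨σ X - 1, strat_mem ?_, trivial⟩, strat_mem ?_⟩,
    ⟨σ X, σ X - 1, strat_mem ?_, ⟨strat_mem ?_, trivial⟩, σ X, ⟨σ X - 1,
      strat_iff (strat_mem ?_) ⟨strat_mem ?_, ?_⟩⟩, strat_mem ?_⟩⟩, strat_mem ?_⟩ <;>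
    simp [StratifiedBy, extend]

end Stratification

/-! ### Derived rules -/

namespace Der

variable {Γ : List Fml}

/-- Weakening to a longer list of hypotheses. -/
theorem up {Δ : List Fml} {φ : Fml} (h : Der Γ φ)
    (hs : Γ ⊆ Δ := by
      repeat (first
        | with_reducible exact List.Subset.refl _
        | assumption
        | apply List.subset_cons_of_subset)) :
    Der Δ φ := h.mono hs

theorem hyp0 {φ : Fml} : Der (φ :: Γ) φ := hyp (by simp)
theorem hyp1 {φ ψ : Fml} : Der (ψ :: φ :: Γ) φ := hyp (by simp)

/-- The new hypothesis is handed over as a derivation, which can be named and later weakened by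
`up`. -/
theorem impI' {φ ψ : Fml} (h : Der (φ :: Γ) φ → Der (φ :: Γ) ψ) : Der Γ (φ ➝ ψ) := impI (h hyp0)

theorem orE' {φ ψ χ : Fml} (h : Der Γ (φ ⋎ ψ)) (h₁ : Der (φ :: Γ) φ → Der (φ :: Γ) χ)
    (h₂ : Der (ψ :: Γ) ψ → Der (ψ :: Γ) χ) : Der Γ χ := orE h (h₁ hyp0) (h₂ hyp0)

theorem cut {φ ψ : Fml} (h : Der Γ φ) (h' : Der (φ :: Γ) ψ) : Der Γ ψ := impE (impI h') h

theorem iffI {φ ψ : Fml} (h : Der (φ :: Γ) ψ) (h' : Der (ψ :: Γ) φ) : Der Γ (iff φ ψ) :=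
  andI (impI h) (impI h')

theorem iffE {φ ψ : Fml} (h : Der Γ (iff φ ψ)) (h' : Der Γ φ) : Der Γ ψ := impE (andL h) h'

theorem iffE' {φ ψ : Fml} (h : Der Γ (iff φ ψ)) (h' : Der Γ ψ) : Der Γ φ := impE (andR h) h'

theorem eqSymm {a b : ℕ} (h : Der Γ (eq a b)) : Der Γ (eq b a) :=
  eqE (φ := eq 0 (a + 1)) h (eqI a)

theorem eqTrans {a b c : ℕ} (h : Der Γ (eq a b)) (h' : Der Γ (eq b c)) : Der Γ (eq a c) :=
  eqE (φ := eq (a + 1) 0) h' h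

theorem memL {a b c : ℕ} (h : Der Γ (eq a b)) (h' : Der Γ (mem a c)) : Der Γ (mem b c) :=
  eqE (φ := mem 0 (c + 1)) h h'

theorem memR {a b c : ℕ} (h : Der Γ (eq a b)) (h' : Der Γ (mem c a)) : Der Γ (mem c b) :=
  eqE (φ := mem (c + 1) 0) h h'

theorem isSuccL {a b c : ℕ} (h : Der Γ (eq a b)) (h' : Der Γ (isSucc a c)) : Der Γ (isSucc b c) :=
  eqE (φ := isSucc 0 (c + 1)) h h'

theorem isSuccR {a b c : ℕ} (h : Der Γ (eq a b)) (h' : Der Γ (isSucc c a)) : Der Γ (isSucc c b) :=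
  eqE (φ := isSucc (c + 1) 0) h h'

theorem ext {a b : ℕ} (h : ∀ t, Der (mem t a :: Γ) (mem t b))
    (h' : ∀ t, Der (mem t b :: Γ) (mem t a)) : Der Γ (eq a b) :=
  impE (allE b (allE a (axm Axm.ext))) (allI' fun t => iffI (h t) (h' t))

theorem ext_iff {a b : ℕ} {φ : Fml} (h : Der Γ (all (iff (mem 0 (a + 1)) φ)))
    (h' : Der Γ (all (iff (mem 0 (b + 1)) φ))) : Der Γ (eq a b) :=
  ext (fun t => iffE' (h'.up.allE t) (iffE (h.up.allE t) hyp0))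
    (fun t => iffE' (h.up.allE t) (iffE (h'.up.allE t) hyp0))

/-- The assignment of the members of `l` to the first variables. -/
def _root_.INF.params (l : List ℕ) (n : ℕ) : ℕ := l.getD n 0

/-- Use of stratified comprehension, with arbitrary parameters. -/
theorem comp {ψ : Fml} (φ : Fml) (hφ : Stratified φ) (l : List ℕ)
    (h : ∀ a, Der (all (iff (mem 0 (a + 1)) (Fml.rename (lift (params l)) φ)) :: Γ) ψ) :
    Der Γ ψ := by
  refine exE' ((axm (Axm.comp φ hφ)).subst (params l) Γ) fun a _ => ?_
  -- The shift that keeps the new set out of its defining formula cancels against `point a`.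
  have e : Fml.rename (lift (point a)) (Fml.rename (lift (lift (params l)))
      (Fml.rename (lift Nat.succ) φ)) = Fml.rename (lift (params l)) φ := by
    simp only [rename_rename, lift_comp]; rfl
  have := h a
  rw [← e] at this
  exact this

/-! ### Elementary set theory -/

theorem isUPair_exists {ψ : Fml} (x y : ℕ) (h : ∀ p, Der (isUPair p x y :: Γ) ψ) : Der Γ ψ :=
  comp (eq 0 1 ⋎ eq 0 2) ⟨fun _ => 0, by simp [StratifiedBy]⟩ [x, y] h

theorem isPair_exists {ψ : Fml} (x y : ℕ) (h : ∀ p, Der (isPair p x y :: Γ) ψ) : Der Γ ψ :=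
  comp (isUPair 0 1 1 ⋎ isUPair 0 1 2) ⟨fun n => if n = 0 then 1 else 0,
    strat_isUPair (by simp) (by simp), strat_isUPair (by simp) (by simp)⟩ [x, y] h

theorem isSucc_exists {ψ : Fml} (x : ℕ) (h : ∀ v, Der (isSucc v x :: Γ) ψ) : Der Γ ψ :=
  comp (ex (succGraph 2 0 ⋏ mem 1 0)) ⟨fun n => if n = 0 then 0 else 1, 1,
    strat_succGraph (by simp [extend]), strat_mem (by simp [extend])⟩ [x] h

theorem isZero_exists {ψ : Fml} (h : ∀ z, Der (isZero z :: Γ) ψ) : Der Γ ψ :=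
  comp (ex (ex (isId 0 ⋏ isPair 2 1 0))) ⟨fun _ => 2, 0, 0, strat_isId,
    strat_isPair (by simp [extend]) (by simp [extend])⟩ [] h

theorem isAdjoin_exists {ψ : Fml} (u c : ℕ) (h : ∀ r, Der (isAdjoin r u c :: Γ) ψ) : Der Γ ψ :=
  comp (mem 0 1 ⋎ eq 0 2) ⟨fun n => if n = 1 then 1 else 0, by simp [StratifiedBy]⟩ [u, c] h

theorem isEmpty_exists {ψ : Fml} (h : ∀ e, Der (isEmpty e :: Γ) ψ) : Der Γ ψ :=
  comp bot ⟨fun _ => 0, trivial⟩ [] fun e =>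
    cut (φ := isEmpty e) (allI' fun t => impI (iffE (hyp1.allE t) hyp0)) ((h e).mono (by simp))

theorem isAdjoin_iff {r u c t : ℕ} (h : Der Γ (isAdjoin r u c)) :
    Der Γ (iff (mem t r) (mem t u ⋎ eq t c)) := h.allE t

theorem isUPair_iff {p x y t : ℕ} (h : Der Γ (isUPair p x y)) :
    Der Γ (iff (mem t p) (eq t x ⋎ eq t y)) := h.allE t

theorem isPair_iff {p x y t : ℕ} (h : Der Γ (isPair p x y)) :
    Der Γ (iff (mem t p) (isUPair t x x ⋎ isUPair t x y)) := h.allE t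

theorem isUPair_left {p x y : ℕ} (h : Der Γ (isUPair p x y)) : Der Γ (mem x p) :=
  iffE' h.isUPair_iff (orL (eqI x))

theorem isUPair_right {p x y : ℕ} (h : Der Γ (isUPair p x y)) : Der Γ (mem y p) :=
  iffE' h.isUPair_iff (orR (eqI y))

theorem isSucc_unique {v w x : ℕ} (h : Der Γ (isSucc v x)) (h' : Der Γ (isSucc w x)) :
    Der Γ (eq v w) := ext_iff h h'

theorem isZero_unique {v w : ℕ} (h : Der Γ (isZero v)) (h' : Der Γ (isZero w)) :
    Der Γ (eq v w) := ext_iff h h'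

theorem isAdjoin_unique {v w u c : ℕ} (h : Der Γ (isAdjoin v u c)) (h' : Der Γ (isAdjoin w u c)) :
    Der Γ (eq v w) := ext_iff h h'

theorem isEmpty_unique {v w : ℕ} (h : Der Γ (isEmpty v)) (h' : Der Γ (isEmpty w)) :
    Der Γ (eq v w) :=
  ext (fun t => botE (impE (h.up.allE t) hyp0)) (fun t => botE (impE (h'.up.allE t) hyp0))

theorem isPair_fst {p x y a b : ℕ} (h : Der Γ (isPair p x y)) (h' : Der Γ (isPair p a b)) :
    Der Γ (eq x a) := by
  refine isUPair_exists x x fun s => ?_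
  have hs : Der (isUPair s x x :: Γ) (mem s p) := iffE' h.up.isPair_iff (orL hyp0)
  have key : ∀ {Δ}, Der Δ (isUPair s x x) → Der Δ (mem a s) → Der Δ (eq x a) := fun h₁ h₂ =>
    orE (iffE h₁.isUPair_iff h₂) hyp0.eqSymm hyp0.eqSymm
  exact orE (iffE h'.up.isPair_iff hs) (key hyp1 hyp0.isUPair_left) (key hyp1 hyp0.isUPair_left)

/-- No case distinction on `x = y` is available. Membership of `{x, y}` in `p` gives `y = a` or `y =
b`, and symmetrically `b = x` or `b = y`; in the one remaining case `y = a = x = b`. -/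
theorem isPair_snd {p x y a b : ℕ} (h : Der Γ (isPair p x y)) (h' : Der Γ (isPair p a b)) :
    Der Γ (eq y b) := by
  have main : ∀ {y a b x}, Der Γ (isPair p x y) → Der Γ (isPair p a b) →
      Der Γ (eq y a ⋎ eq y b) := by
    intro y a b x h h'
    refine isUPair_exists x y fun s => ?_
    have hs : Der (isUPair s x y :: Γ) (mem s p) := iffE' h.up.isPair_iff (orR hyp0)
    refine orE (iffE h'.up.isPair_iff hs) ?_ ?_
    · exact orE (iffE hyp0.isUPair_iff hyp1.isUPair_right) (orL hyp0) (orL hyp0)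
    · exact iffE hyp0.isUPair_iff hyp1.isUPair_right
  have hx := isPair_fst h h'
  refine orE (main h h') ?_ hyp0
  refine orE (main h' h).up ?_ hyp0.eqSymm
  exact eqTrans hyp1 (eqTrans hx.eqSymm.up hyp0.eqSymm)

/-! ### Finite sets -/

theorem finite_empty {e : ℕ} (h : Der Γ (isEmpty e)) : Der Γ (finite e) :=
  allI' fun _ => impI' fun hW => exE' hW.andL fun _ he =>
    memL (isEmpty_unique he.andL h.up) he.andR

theorem finite_adjoin {u c r : ℕ} (h : Der Γ (finite u)) (hc : Der Γ (neg (mem c u)))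
    (hr : Der Γ (isAdjoin r u c)) : Der Γ (finite r) := by
  refine allI' fun W => impI' fun hW => ?_
  have hu := impE (h.up.allE W) hW
  exact exE' (impE (impE ((hW.andR.allE u).allE c) hu) hc.up) fun r' hr' =>
    memL (isAdjoin_unique hr'.andL hr.up) hr'.andR

theorem finite_congr {a b : ℕ} (h : Der Γ (eq a b)) (h' : Der Γ (finite a)) : Der Γ (finite b) :=
  eqE (φ := finite 0) h h'

end Der

/-! ### Church numbers -/

/-- `X` is closed under Church successor. -/
def closed (X : ℕ) : Fml := all (mem 0 (X + 1) ➝ ex (isSucc 0 1 ⋏ mem 0 (X + 2)))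

/-- `u` is closed under Church successor, except possibly at `k`. -/
def closedExcept (u k : ℕ) : Fml :=
  all (all (mem 1 (u + 2) ➝ isSucc 0 1 ➝ (eq 1 (k + 2) ⋎ mem 0 (u + 2))))

/-- `u` is included in every set that contains `z` and is closed under Church successor within
`u`. -/
def generated (u z : ℕ) : Fml :=
  all (mem (z + 1) 0 ➝
    all (all (mem 1 2 ➝ mem 1 (u + 3) ➝ isSucc 0 1 ➝ mem 0 (u + 3) ➝ mem 0 2)) ➝
    all (mem 0 (u + 2) ➝ mem 0 1))

/-- `u` is a finite set of numbers that leads from `z` to `k` by steps of Church successor. -/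
def segment (u k z : ℕ) : Fml :=
  finite u ⋏ mem z u ⋏ mem k u ⋏ closedExcept u k ⋏ generated u z

/-- With `u` one above `k` and `z`, the existence of a segment is a stratified property of `k`,
hence open to induction. -/
theorem strat_segment {σ : ℕ → ℤ} {u k z : ℕ} (h : σ u = σ k + 1) (h' : σ z = σ k) :
    StratifiedBy σ (segment u k z) := by
  refine ⟨strat_finite, strat_mem ?_, strat_mem ?_,
    ⟨σ k, σ k, strat_mem ?_, strat_isSucc ?_, ?_, strat_mem ?_⟩,
    σ k + 1, strat_mem ?_, ⟨σ k, σ k, strat_mem ?_, strat_mem ?_, strat_isSucc ?_, strat_mem ?_,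
      strat_mem ?_⟩, σ k, strat_mem ?_, strat_mem ?_⟩ <;>
    simp [StratifiedBy, extend, h, h']

namespace Der

variable {Γ : List Fml}

theorem closed_intro {X : ℕ}
    (h : ∀ x v, Der (isSucc v x :: mem x X :: Γ) (mem x X) →
      Der (isSucc v x :: mem x X :: Γ) (isSucc v x) →
      Der (isSucc v x :: mem x X :: Γ) (mem v X)) : Der Γ (closed X) :=
  allI' fun x => impI <| isSucc_exists x fun v => exI v (andI hyp0 (h x v hyp1 hyp0))

theorem closed_elim {X x v : ℕ} (h : Der Γ (closed X)) (hx : Der Γ (mem x X))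
    (hv : Der Γ (isSucc v x)) : Der Γ (mem v X) :=
  exE' (impE (h.allE x) hx) fun _ hw => memL (isSucc_unique hw.andL hv.up) hw.andR

theorem closedExcept_intro {u k : ℕ}
    (h : ∀ x v, Der (isSucc v x :: mem x u :: Γ) (mem x u) →
      Der (isSucc v x :: mem x u :: Γ) (isSucc v x) →
      Der (isSucc v x :: mem x u :: Γ) (eq x k ⋎ mem v u)) : Der Γ (closedExcept u k) :=
  allI' fun x => allI' fun v => impI <| impI (h x v hyp1 hyp0)

theorem closedExcept_elim {u k x v : ℕ} (h : Der Γ (closedExcept u k)) (hx : Der Γ (mem x u))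
    (hv : Der Γ (isSucc v x)) : Der Γ (eq x k ⋎ mem v u) :=
  impE (impE ((h.allE x).allE v) hx) hv

/-- The enlarged context is hidden behind an arbitrary `Δ`, so that weakening needs only `Γ ⊆ Δ`. -/
theorem generated_intro {u z : ℕ}
    (h : ∀ X t Δ, Γ ⊆ Δ → Der Δ (mem z X) →
      (∀ x v, Der Δ (mem x X ➝ mem x u ➝ isSucc v x ➝ mem v u ➝ mem v X)) →
      Der Δ (mem t u) → Der Δ (mem t X)) : Der Γ (generated u z) :=
  allI' fun X => impI' fun hX => impI' fun hc => allI' fun t => impI' fun ht =>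
    h X t _ (fun _ h => by simp [h]) hX.up (fun x v => (hc.up.allE x).allE v) ht

theorem generated_elim {u z X t : ℕ} (h : Der Γ (generated u z)) (hz : Der Γ (mem z X))
    (hX : ∀ x v, Der Γ (mem x X ➝ mem x u ➝ isSucc v x ➝ mem v u ➝ mem v X))
    (ht : Der Γ (mem t u)) : Der Γ (mem t X) :=
  impE ((impE (impE (h.allE X) hz) (allI' fun x => allI' fun v => hX x v)).allE t) ht

/-! ### Existence of the set of Church numbers, closure and induction -/

theorem isChurchNumbers_exists {ψ : Fml} (h : ∀ N, Der (isChurchNumbers N :: Γ) ψ) : Der Γ ψ :=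
  comp (ex (isZero 0 ⋏ all (mem 1 0 ⋏ all (mem 0 1 ➝ ex (isSucc 0 1 ⋏ mem 0 2)) ➝ mem 2 0)))
    ⟨fun _ => 0, 0, strat_isZero, 1, ⟨strat_mem (by simp [extend]), 0,
      strat_mem (by simp [extend]), 0, strat_isSucc (by simp [extend]),
      strat_mem (by simp [extend])⟩, strat_mem (by simp [extend])⟩ [] h

variable {N z : ℕ}

theorem isChurchNumbers_iff (hN : Der Γ (isChurchNumbers N)) (t : ℕ) :
    Der Γ (iff (mem t N)
      (ex (isZero 0 ⋏ all (mem 1 0 ⋏ closed 0 ➝ mem (t + 2) 0)))) := hN.allE t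

theorem church_elim {k X : ℕ} (hN : Der Γ (isChurchNumbers N)) (hz : Der Γ (isZero z))
    (hk : Der Γ (mem k N)) (hX : Der Γ (mem z X)) (hc : Der Γ (closed X)) : Der Γ (mem k X) := by
  refine exE' (iffE (isChurchNumbers_iff hN k) hk) fun z' h => ?_
  have h' : Der _ (mem z' X ⋏ closed X ➝ mem k X) := h.andR.allE X
  exact impE h' (andI (memL (isZero_unique hz.up h.andL) hX.up) hc.up)

theorem church_intro {k : ℕ} (hN : Der Γ (isChurchNumbers N)) (hz : Der Γ (isZero z))
    (h : ∀ X, Der ((mem z X ⋏ closed X) :: Γ) (mem k X)) : Der Γ (mem k N) :=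
  iffE' (isChurchNumbers_iff hN k) (exI z (andI hz (allI' fun X => impI (h X))))

theorem church_zero (hN : Der Γ (isChurchNumbers N)) (hz : Der Γ (isZero z)) : Der Γ (mem z N) :=
  church_intro hN hz fun _ => hyp0.andL

theorem church_succ (hN : Der Γ (isChurchNumbers N)) {x v : ℕ} (hx : Der Γ (mem x N))
    (hv : Der Γ (isSucc v x)) : Der Γ (mem v N) := by
  refine isZero_exists fun z => church_intro hN.up hyp0 fun X => ?_
  exact closed_elim hyp0.andR (church_elim hN.up hyp1 hx.up hyp0.andL hyp0.andR) hv.up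

/-- Induction on Church numbers for stratified formulas, with parameters. -/
theorem church_induction (hN : Der Γ (isChurchNumbers N)) (hz : Der Γ (isZero z)) (φ : Fml)
    (hφ : Stratified φ) (l : List ℕ) (P : ℕ → Fml)
    (hP : ∀ x, P x = (Fml.rename (lift (params l)) φ).inst x)
    (h0 : Der Γ (P z)) (hS : ∀ x v, Der Γ (P x ➝ isSucc v x ➝ P v))
    {k : ℕ} (hk : Der Γ (mem k N)) : Der Γ (P k) := by
  refine comp φ hφ l fun X => ?_
  have hX : ∀ t, Der (all (iff (mem 0 (X + 1)) (Fml.rename (lift (params l)) φ)) :: Γ)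
      (iff (mem t X) (P t)) := fun t => hP t ▸ hyp0.allE t
  refine iffE (hX k) (church_elim hN.up hz.up hk.up (iffE' (hX z) h0.up) ?_)
  exact closed_intro fun x v hx hv =>
    iffE' (hX v).up (impE (impE (hS x v).up (iffE (hX x).up hx)) hv)

/-- Every Church number is zero or the successor of a Church number. -/
theorem church_cases (hN : Der Γ (isChurchNumbers N)) (hz : Der Γ (isZero z)) {k : ℕ}
    (hk : Der Γ (mem k N)) : Der Γ (eq k z ⋎ ex (mem 0 (N + 1) ⋏ isSucc (k + 1) 0)) := by
  -- Membership in `N` is part of the induction formula, since the induction step assumes nothing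
  -- else about `x`.
  refine andR (church_induction hN hz (mem 0 1 ⋏ (eq 0 2 ⋎ ex (mem 0 2 ⋏ isSucc 1 0)))
    ⟨fun n => if n = 1 then 1 else 0, strat_mem (by simp), by simp [StratifiedBy], 0,
      strat_mem (by simp [extend]), strat_isSucc (by simp [extend])⟩ [N, z]
    (fun x => mem x N ⋏ (eq x z ⋎ ex (mem 0 (N + 1) ⋏ isSucc (x + 1) 0))) (fun _ => rfl)
    (andI (church_zero hN hz) (orL (eqI z))) (fun x v => impI' fun hx => impI' fun hv => ?_) hk)
  exact andI (church_succ hN.up hx.andL.up hv) (orR (exI x (andI hx.andL.up hv)))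

/-! ### Segments -/

/-- The successor of the last element of a segment is outside it. -/
theorem segment_succ (hN : Der Γ (isChurchNumbers N)) (hf : Der Γ (neg (finite N)))
    (hz : Der Γ (isZero z)) {u k v : ℕ} (hu : Der Γ (segment u k z)) (hv : Der Γ (isSucc v k)) :
    Der Γ (neg (mem v u)) := by
  -- If `v ∈ u`, the exception at `k` disappears and `u = N`: generation gives `u ⊆ N`, induction
  -- gives `N ⊆ u`.
  refine impI' fun h => impE hf.up (finite_congr (ext (a := u) (fun t => ?_) fun t => ?_)
    hu.andL.up)
  · refine generated_elim hu.andR.andR.andR.andR.up (church_zero hN.up hz.up) (fun x w => ?_) hyp0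
    exact impI' fun hx => impI <| impI' fun hw => impI (church_succ hN.up hx.up hw.up)
  · refine church_elim hN.up hz.up hyp0 hu.andR.andL.up (closed_intro fun x w hx hw => ?_)
    refine orE' (closedExcept_elim hu.andR.andR.andR.andL.up hx hw) (fun e => ?_) id
    exact memL (isSucc_unique hv.up (isSuccR e hw.up)) h.up

/-- In `{z}` the only element is the exception, so closure is vacuous there. -/
theorem segment_zero {e u : ℕ} (he : Der Γ (isEmpty e)) (hu : Der Γ (isAdjoin u e z)) :
    Der Γ (segment u z z) := by
  have hz : Der Γ (mem z u) := iffE' hu.isAdjoin_iff (orR (eqI z))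
  have hmem : ∀ t, Der Γ (mem t u ➝ eq t z) := fun t => impI' fun ht =>
    orE' (iffE hu.up.isAdjoin_iff ht) (fun h => botE (impE (he.up.allE t) h)) id
  refine andI (finite_adjoin (finite_empty he) (he.allE z) hu) (andI hz (andI hz (andI ?_ ?_)))
  · exact closedExcept_intro fun x w hx hw => orL (impE (hmem x).up hx)
  · exact generated_intro fun X t Δ hΔ hX _ ht => memL (impE (hmem t).up ht).eqSymm hX

/-- Adjoining `v` removes the exception at `k` and creates one at `v`. A set containing `z` and
closed within `r` is closed within `u`, so it includes `u`; thus it contains `k`, and then `v`. -/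
theorem segment_adjoin {k v u r : ℕ} (hu : Der Γ (segment u k z)) (hv : Der Γ (isSucc v k))
    (hn : Der Γ (neg (mem v u))) (hr : Der Γ (isAdjoin r u v)) : Der Γ (segment r v z) := by
  have hvr : Der Γ (mem v r) := iffE' hr.isAdjoin_iff (orR (eqI v))
  have hku : Der Γ (mem k u) := hu.andR.andR.andL
  have hsub : ∀ t, Der Γ (mem t u ➝ mem t r) := fun t =>
    impI (iffE' hr.up.isAdjoin_iff (orL hyp0))
  refine andI (finite_adjoin hu.andL hn hr)
    (andI (impE (hsub z) hu.andR.andL) (andI hvr (andI ?_ ?_)))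
  · refine closedExcept_intro fun x w hx hw => ?_
    refine orE' (iffE hr.up.isAdjoin_iff hx) (fun hx => orR ?_) orL
    refine orE' (closedExcept_elim hu.andR.andR.andR.andL.up hx hw.up) (fun e => ?_)
      (impE (hsub w).up)
    exact memL (isSucc_unique hv.up (isSuccR e hw.up)) hvr.up
  · refine generated_intro fun X t Δ hΔ hX hc ht => ?_
    have key : ∀ t, Der Δ (mem t u ➝ mem t X) := fun t => impI' fun ht =>
      generated_elim hu.andR.andR.andR.andR.up hX.up (fun x w => impI' fun h₁ => impI' fun h₂ =>
        impI' fun h₃ => impI' fun h₄ => impE (impE (impE (impE (hc x w).up h₁.up)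
          (impE (hsub x).up h₂.up)) h₃.up) (impE (hsub w).up h₄)) ht
    refine orE' (iffE hr.up.isAdjoin_iff ht) (fun ht => impE (key t).up ht) fun e => ?_
    exact memL e.eqSymm (impE (impE (impE (impE (hc k v) (impE (key k) hku.up))
      (impE (hsub k) hku).up) hv.up) hvr.up |>.up)

/-- Every Church number is the last element of a segment. -/
theorem segment_exists (hN : Der Γ (isChurchNumbers N)) (hf : Der Γ (neg (finite N)))
    (hz : Der Γ (isZero z)) {k : ℕ} (hk : Der Γ (mem k N)) :
    Der Γ (ex (segment 0 (k + 1) (z + 1))) := by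
  refine church_induction hN hz (ex (segment 0 1 2)) ⟨fun _ => 0, 1,
    strat_segment (by simp [extend]) (by simp [extend])⟩ [z]
    (fun x => ex (segment 0 (x + 1) (z + 1))) (fun _ => rfl) ?_ (fun k v => ?_) hk
  · exact isEmpty_exists fun e => isAdjoin_exists e z fun u => exI u (segment_zero hyp1 hyp0)
  · refine impI' fun h => impI' fun hv => exE' h.up fun u hu => ?_
    refine isAdjoin_exists u v fun r => exI r ?_
    exact segment_adjoin hu.up hv.up (segment_succ hN.up hf.up hz.up hu.up hv.up) hyp0

end Der

namespace Der

variable {Γ : List Fml} {N z : ℕ}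

/-! ### Church successor on an infinite set of Church numbers -/

theorem zero_ne_succ (hN : Der Γ (isChurchNumbers N)) (hf : Der Γ (neg (finite N)))
    (hz : Der Γ (isZero z)) {x : ℕ} (hx : Der Γ (mem x N)) (h : Der Γ (isSucc z x)) :
    Der Γ bot :=
  exE' (segment_exists hN hf hz hx) fun _ hu =>
    impE (segment_succ hN.up hf.up hz.up hu h.up) hu.andR.andL

/-- Different last elements of segments do not have a common successor outside both segments. -/
theorem segment_succ_ne {x y v u w : ℕ} (hu : Der Γ (segment u x z)) (hw : Der Γ (segment w y z))
    (hxy : Der Γ (neg (eq x y))) (hvx : Der Γ (isSucc v x)) (hvy : Der Γ (isSucc v y))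
    (hvu : Der Γ (neg (mem v u))) (hvw : Der Γ (neg (mem v w))) : Der Γ bot := by
  -- Were `y` in `u`, it would be the exception `x` or its successor `v` would be in `u`.
  have hyu : Der Γ (neg (mem y u)) := impI' fun h =>
    orE' (closedExcept_elim hu.andR.andR.andR.andL.up h hvy.up) (fun e => impE hxy.up e.eqSymm)
      (impE hvu.up)
  -- Generation of `u` is applied to the set `w`: a step of successor could leave `w` only at `y`,
  -- which is not in `u`.
  have hxw : Der Γ (mem x w) := generated_elim hu.andR.andR.andR.andR hw.andR.andL
    (fun a b => impI' fun ha => impI' fun ha' => impI' fun hb => impI <|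
      orE' (closedExcept_elim hw.andR.andR.andR.andL.up ha.up hb.up)
        (fun e => botE (impE hyu.up (memL e ha'.up))) id)
    hu.andR.andR.andL
  exact orE' (closedExcept_elim hw.andR.andR.andR.andL hxw hvx) (impE hxy.up) (impE hvw.up)

theorem succ_weakly_injective (hN : Der Γ (isChurchNumbers N)) (hf : Der Γ (neg (finite N)))
    {x y v : ℕ} (hx : Der Γ (mem x N)) (hy : Der Γ (mem y N)) (hxy : Der Γ (neg (eq x y)))
    (hvx : Der Γ (isSucc v x)) (hvy : Der Γ (isSucc v y)) : Der Γ bot := by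
  refine isZero_exists fun z => ?_
  have hz : Der (isZero z :: Γ) (isZero z) := hyp0
  refine exE' (segment_exists hN.up hf.up hz hx.up) fun u hu => ?_
  refine exE' (segment_exists hN.up hf.up hz.up hy.up) fun w hw => ?_
  exact segment_succ_ne hu.up hw hxy.up hvx.up hvy.up
    (segment_succ hN.up hf.up hz.up hu.up hvx.up) (segment_succ hN.up hf.up hz.up hw hvy.up)

/-- Induction on `x`, with `y` zero or a successor. Zero is never a successor; for `S x` and `S p`
the decision between `x` and `p` carries over, the negative case by weak injectivity. -/
theorem church_decidableEq (hN : Der Γ (isChurchNumbers N)) (hf : Der Γ (neg (finite N)))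
    {x y : ℕ} (hx : Der Γ (mem x N)) (hy : Der Γ (mem y N)) :
    Der Γ (eq x y ⋎ neg (eq x y)) := by
  have main : Der Γ (mem x N ⋏
      all (mem 0 (N + 1) ➝ (eq (x + 1) 0 ⋎ neg (eq (x + 1) 0)))) := by
    refine isZero_exists fun z => ?_
    have hz : Der (isZero z :: Γ) (isZero z) := hyp0
    refine church_induction hN.up hz (mem 0 1 ⋏ all (mem 0 2 ➝ (eq 1 0 ⋎ neg (eq 1 0))))
      ⟨fun n => if n = 1 then 1 else 0, strat_mem (by simp), 0, strat_mem (by simp [extend]),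
        by simp [Fml.neg, StratifiedBy, extend]⟩ [N]
      (fun x => mem x N ⋏ all (mem 0 (N + 1) ➝ (eq (x + 1) 0 ⋎ neg (eq (x + 1) 0))))
      (fun _ => rfl) (andI (church_zero hN.up hz) (allI' fun y => impI' fun hy => ?_))
      (fun x v => impI' fun hx => impI' fun hv => andI (church_succ hN.up hx.andL.up hv)
        (allI' fun y => impI' fun hy => ?_)) hx.up
    · refine orE' (church_cases hN.up hz.up hy) (fun e => orL e.eqSymm) fun h => ?_
      refine exE' h fun p hp => orR <| impI' fun e => ?_
      exact zero_ne_succ (x := p) hN.up hf.up hz.up hp.andL.up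
        (isSuccL e.eqSymm hp.andR.up)
    · refine orE' (church_cases hN.up hz.up hy) (fun e => orR <| impI' fun e' => ?_)
        fun h => exE' h fun p hp => ?_
      · exact zero_ne_succ (x := x) hN.up hf.up hz.up hx.andL.up
          (isSuccL (eqTrans e' e.up) hv.up)
      · have hp₁ : Der _ (mem p N) := hp.andL
        have hp₂ : Der _ (isSucc y p) := hp.andR
        have hd := impE (φ := mem p N) (ψ := eq x p ⋎ neg (eq x p)) (hx.andR.up.allE p) hp₁
        refine orE' hd (fun e => orL (isSucc_unique hv.up (isSuccR e.eqSymm hp₂.up))) fun h =>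
          orR <| impI' fun e => ?_
        exact succ_weakly_injective hN.up hf.up hx.andL.up hp₁.up h.up hv.up
          (isSuccL (eqSymm e) hp₂.up)
  exact impE (main.andR.allE y) hy

/-- Weak injectivity refutes only `x ≠ y`; decidable equality turns this into `x = y`. -/
theorem succ_injective (hN : Der Γ (isChurchNumbers N)) (hf : Der Γ (neg (finite N)))
    {x y v : ℕ} (hx : Der Γ (mem x N)) (hy : Der Γ (mem y N))
    (hvx : Der Γ (isSucc v x)) (hvy : Der Γ (isSucc v y)) : Der Γ (eq x y) :=
  orE' (church_decidableEq hN hf hx hy) id fun h =>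
    botE (succ_weakly_injective hN.up hf.up hx.up hy.up h hvx.up hvy.up)

/-! ### Similarity of the Church numbers with their successors -/

/-- `f` is the graph of Church successor on `N`. -/
def _root_.INF.isSuccGraph (f N : ℕ) : Fml :=
  all (iff (mem 0 (f + 1)) (ex (ex (isPair 2 1 0 ⋏ mem 1 (N + 3) ⋏ isSucc 0 1))))

/-- `Y` is the image of `N` under Church successor. -/
def _root_.INF.isSuccImage (Y N : ℕ) : Fml :=
  all (iff (mem 0 (Y + 1)) (ex (mem 0 (N + 2) ⋏ isSucc 1 0)))

theorem isSuccGraph_exists {ψ : Fml} (h : ∀ f, Der (isSuccGraph f N :: Γ) ψ) : Der Γ ψ :=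
  comp (ex (ex (isPair 2 1 0 ⋏ mem 1 3 ⋏ isSucc 0 1))) ⟨fun n => if n = 1 then 1 else 2, 0, 0,
    strat_isPair (by simp [extend]) (by simp [extend]), strat_mem (by simp [extend]),
    strat_isSucc (by simp [extend])⟩ [N] h

theorem isSuccImage_exists {ψ : Fml} (h : ∀ Y, Der (isSuccImage Y N :: Γ) ψ) : Der Γ ψ :=
  comp (ex (mem 0 2 ⋏ isSucc 1 0)) ⟨fun n => if n = 1 then 1 else 0, 0,
    strat_mem (by simp [extend]), strat_isSucc (by simp [extend])⟩ [N] h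

theorem isSuccGraph_iff {f p : ℕ} (h : Der Γ (isSuccGraph f N)) :
    Der Γ (iff (mem p f) (ex (ex (isPair (p + 2) 1 0 ⋏ mem 1 (N + 2) ⋏ isSucc 0 1)))) := h.allE p

theorem isSuccImage_iff {Y y : ℕ} (h : Der Γ (isSuccImage Y N)) :
    Der Γ (iff (mem y Y) (ex (mem 0 (N + 1) ⋏ isSucc (y + 1) 0))) := h.allE y

theorem pairMem_isSuccGraph_intro {f x y : ℕ} (h : Der Γ (isSuccGraph f N)) (hx : Der Γ (mem x N))
    (hy : Der Γ (isSucc y x)) : Der Γ (pairMem x y f) :=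
  isPair_exists x y fun p => exI p (andI hyp0 (iffE' h.up.isSuccGraph_iff
    (exI x (exI y (andI hyp0 (andI hx.up hy.up))))))

theorem pairMem_isSuccGraph_elim {f x y : ℕ} (h : Der Γ (isSuccGraph f N))
    (hp : Der Γ (pairMem x y f)) : Der Γ (mem x N ⋏ isSucc y x) := by
  refine exE' hp fun p hp => ?_
  refine exE' (iffE (h.up.isSuccGraph_iff (p := p)) hp.andR) fun a ha => exE' ha fun b hb => ?_
  have hab : Der _ (isPair p a b) := hb.andL
  have e₁ := isPair_fst hab hp.andL.up
  have e₂ := isPair_snd hab hp.andL.up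
  exact andI (memL e₁ hb.andR.andL) (isSuccL e₂ (isSuccR e₁ hb.andR.andR))

/-- The proper subset is the image `Y` of successor, which lacks zero; the similarity is the graph
of successor restricted to `N`. -/
theorem church_infinite (hN : Der Γ (isChurchNumbers N)) (hf : Der Γ (neg (finite N))) :
    Der Γ (infinite N) := by
  refine isSuccImage_exists (N := N) fun Y => isSuccGraph_exists (N := N) fun f => ?_
  have hN : Der (isSuccGraph f N :: isSuccImage Y N :: Γ) (isChurchNumbers N) := hN.up
  have hf : Der (isSuccGraph f N :: isSuccImage Y N :: Γ) (neg (finite N)) := hf.up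
  have hY : Der (isSuccGraph f N :: isSuccImage Y N :: Γ) (isSuccImage Y N) := hyp1
  have hF : Der (isSuccGraph f N :: isSuccImage Y N :: Γ) (isSuccGraph f N) := hyp0
  -- From here on the context matters only through the four facts just derived.
  generalize isSuccGraph f N :: isSuccImage Y N :: Γ = Δ at *
  have hfun : ∀ x y, Der Δ (pairMem x y f ➝ (mem x N ⋏ isSucc y x)) := fun x y =>
    impI (pairMem_isSuccGraph_elim hF.up hyp0)
  have hsub : Der Δ (subset Y N) := allI' fun y => impI' fun hy =>
    exE' (iffE hY.up.isSuccImage_iff hy) fun x hx => church_succ hN.up hx.andL hx.andR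
  have hne : Der Δ (neg (eq Y N)) := impI' fun e => isZero_exists fun z =>
    exE' (iffE hY.up.isSuccImage_iff (memR e.eqSymm.up (church_zero hN.up hyp0))) fun x hx =>
      zero_ne_succ hN.up hf.up hyp1 hx.andL hx.andR
  have hrel : Der Δ (isRel f) := allI' fun p => impI' fun hp =>
    exE' (iffE hF.up.isSuccGraph_iff hp) fun x hx => exE' hx fun y hy => exI x (exI y hy.andL)
  have hfunc : Der Δ (isFunc f) := allI' fun x => allI' fun y => allI' fun w =>
    impI' fun hy => impI' fun hw => isSucc_unique (impE (hfun x y).up hy.up).andR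
      (impE (hfun x w).up hw).andR
  have hdom : Der Δ (domSubset f N) := allI' fun x => allI' fun y =>
    impI' fun h => (impE (hfun x y).up h).andL
  have hmaps : Der Δ (maps f N Y) := allI' fun x => impI' fun hx =>
    isSucc_exists x fun v => exI v (andI
      (iffE' hY.up.isSuccImage_iff (exI x (andI hx.up hyp0)))
      (andI (pairMem_isSuccGraph_intro hF.up hx.up hyp0)
        (allI' fun w => impI' fun hw => isSucc_unique (impE (hfun x w).up hw).andR hyp1)))
  have hinj : Der Δ (all (all (all (pairMem 2 0 (f + 3) ➝ pairMem 1 0 (f + 3) ➝ eq 2 1)))) :=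
    allI' fun x => allI' fun y => allI' fun v => impI' fun hx => impI' fun hy =>
      succ_injective hN.up hf.up (impE (hfun x v).up hx.up).andL (impE (hfun y v).up hy).andL
        (impE (hfun x v).up hx.up).andR (impE (hfun y v).up hy).andR
  have hone : Der Δ (oneOne f N Y) := andI hmaps (andI hinj (allI' fun x => allI' fun y =>
    impI' fun h => impI (impE (hfun x y).up h.up).andL))
  have honto : Der Δ (onto f N Y) := allI' fun y => impI' fun hy =>
    exE' (iffE hY.up.isSuccImage_iff hy) fun x hx =>
      exI x (andI hx.andL (pairMem_isSuccGraph_intro hF.up hx.andL hx.andR))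
  exact exI Y (andI hsub (andI hne
    (exI f (andI hrel (andI hfunc (andI hdom (andI hone honto)))))))

theorem church_main (hN : Der Γ (isChurchNumbers N)) (hf : Der Γ (neg (finite N))) :
    Der Γ (succWeaklyOneOne N ⋏ succOneOne N ⋏ decidableEq N ⋏ infinite N) := by
  refine andI ?_ (andI ?_ (andI ?_ (church_infinite hN hf)))
  · exact allI' fun x => allI' fun y => impI' fun hx => impI' fun hy => impI' fun hxy =>
      impI' fun h => exE' h fun v hv => succ_weakly_injective hN.up hf.up hx.up hy.up hxy.up
        hv.andL hv.andR
  · exact allI' fun x => allI' fun y => impI' fun hx => impI' fun hy => impI' fun h =>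
      exE' h fun v hv => succ_injective hN.up hf.up hx.up hy.up hv.andL hv.andR
  · exact allI' fun x => allI' fun y => impI' fun hx => impI' fun hy =>
      church_decidableEq hN.up hf.up hx.up hy

end Der
end INF

theorem mainTheorem3 :
    INF.Provable (INF.Fml.ex (INF.isChurchNumbers 0)) ∧
    INF.Provable (INF.Fml.all
      (INF.isChurchNumbers 0 ➝ INF.Fml.neg (INF.finite 0) ➝
        (INF.succWeaklyOneOne 0 ⋏ INF.succOneOne 0 ⋏ INF.decidableEq 0 ⋏ INF.infinite 0))) := by
  exact ⟨INF.Der.isChurchNumbers_exists fun N => INF.Der.exI N INF.Der.hyp0,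
    INF.Der.allI' fun N => INF.Der.impI (INF.Der.impI
      (INF.Der.church_main INF.Der.hyp1 INF.Der.hyp0))⟩
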